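/- Let $\mathcal H$ be a complex Hilbert space, $\mathbb B(\mathcal H)$ the algebra of bounded linear operators on $\mathcal H$, and $|X|=(X^*X)^{1/2}$ for $X\in\mathbb B(\mathcal H)$. Let $w(T)=\sup_{\|z\|=1}|\langle Tz,z\rangle|$ denote the numerical radius. For $\rho>0$, call $X\in\mathbb B(\mathcal H)$ a $\rho$-contraction if there are a Hilbert space $\mathcal K\supseteq\mathcal H$ and a unitary operator $U$ on $\mathcal K$ such that $X^nx=\rho PU^nx$ for all $x\in\mathcal H$ and $n=1,2,\dots$, where $P$ is the orthogonal projection of $\mathcal K$ onto $\mathcal H$; put $$w_\rho(X)=\inf\{t>0:\ t^{-1}X\text{ is a }\rho\text{-contraction}\}.$$ Let $\rho\in(0,2]$, $\nu\in[0,1]$, $\alpha=\sqrt{8\rho^{-1}-4}$, $\beta=2\rho^{-1}-2$, and for $X\in\mathbb B(\mathcal H)$ let $$\Delta_{(\rho,\nu)}(X)=w\left(\begin{bmatrix}0&\alpha X\\ \alpha(1-2\nu)X^*&\beta\left(X+(1-2\nu)X^*\right)\end{bmatrix}\right),$$ the operator matrix acting on the Hilbert space direct sum $\mathcal H\oplus\mathcal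 H$. Then for every $X\in\mathbb B(\mathcal H)$ and every $\lambda\in\mathbb C\setminus\{0\}$, $$\Delta_{(\rho,\nu)}(X)^2\le(1-2\nu)^2\,w_\rho(X)^2+2\left|\frac{(1-2\nu)\beta}{\lambda}\right|w_\rho(X^2)+\frac{2|1-2\nu|\max\{1,|\lambda-1|\}+|\lambda|}{2|\lambda|}\left\|\begin{bmatrix}\mathbf A&\mathbf B\\ \mathbf B&\mathbf C\end{bmatrix}\right\|,$$ where $\mathbf A=\alpha^2|X^*|^2$, $\mathbf B=\alpha\beta|X^*|^2$, $\mathbf C=(\alpha^2+\beta^2)|X|^2+\beta^2|X^*|^2$, and $\|\cdot\|$ is the operator norm on $\mathbb B(\mathcal H\oplus\mathcal H)$. -/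

import Mathlib

namespace OperatorRadii

universe u

/-- The numerical radius `w(T) = sup {|⟨Tz, z⟩| : ‖z‖ = 1}`. -/
noncomputable def numericalRadius {E : Type u} [NormedAddCommGroup E] [InnerProductSpace ℂ E]
    (T : E →L[ℂ] E) : ℝ :=
  sSup {r : ℝ | ∃ z : E, ‖z‖ = 1 ∧ r = ‖inner ℂ (T z) z‖}

/-- `X` is a `ρ`-contraction: there are a Hilbert space `K` containing `H` (through an isometric
embedding `J`) and a unitary `U` on `K` with `Xⁿ x = ρ P Uⁿ x` for all `x ∈ H` and `n ≥ 1`.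
The orthogonal projection of `K` onto `H`, as a map into `H`, is the adjoint of `J`. -/
def IsRhoContraction {H : Type u} [NormedAddCommGroup H] [InnerProductSpace ℂ H] [CompleteSpace H]
    (ρ : ℝ) (X : H →L[ℂ] H) : Prop :=
  ∃ (K : Type u) (_ : NormedAddCommGroup K) (_ : InnerProductSpace ℂ K) (_ : CompleteSpace K)
    (J : H →ₗᵢ[ℂ] K) (U : K →L[ℂ] K), U ∈ unitary (K →L[ℂ] K) ∧
      ∀ n : ℕ, 1 ≤ n → ∀ x : H,
        (X ^ n) x =
          (ρ : ℂ) • ContinuousLinearMap.adjoint J.toContinuousLinearMap ((U ^ n) (J x))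

/-- The operator radius `w_ρ(X) = inf {t > 0 : t⁻¹ X is a ρ-contraction}`. -/
noncomputable def operatorRadius {H : Type u} [NormedAddCommGroup H] [InnerProductSpace ℂ H]
    [CompleteSpace H] (ρ : ℝ) (X : H →L[ℂ] H) : ℝ :=
  sInf {t : ℝ | 0 < t ∧ IsRhoContraction ρ (((t⁻¹ : ℝ) : ℂ) • X)}

/-- The operator matrix `[[S, X], [Y, T]]` on the Hilbert space direct sum `H ⊕ H`. -/
noncomputable def blockOp {H : Type u} [NormedAddCommGroup H] [InnerProductSpace ℂ H]
    (S X Y T : H →L[ℂ] H) : WithLp 2 (H × H) →L[ℂ] WithLp 2 (H × H) :=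
  (WithLp.prodContinuousLinearEquiv 2 ℂ H H).symm.toContinuousLinearMap ∘L
    ((S.coprod X).prod (Y.coprod T)) ∘L
      (WithLp.prodContinuousLinearEquiv 2 ℂ H H).toContinuousLinearMap

theorem blockOp_apply {H : Type u} [NormedAddCommGroup H] [InnerProductSpace ℂ H]
    (S X Y T : H →L[ℂ] H) (h k : H) :
    blockOp S X Y T (WithLp.toLp 2 (h, k)) = WithLp.toLp 2 (S h + X k, Y h + T k) :=
  rfl

/-- `α = √(8ρ⁻¹ - 4)`. -/
noncomputable def alpha (ρ : ℝ) : ℝ := Real.sqrt (8 * ρ⁻¹ - 4)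

/-- `β = 2ρ⁻¹ - 2`. -/
noncomputable def beta (ρ : ℝ) : ℝ := 2 * ρ⁻¹ - 2

/-- `Δ_(ρ,ν)(X)`, the numerical radius of
`[[0, α X], [α (1 - 2ν) X*, β (X + (1 - 2ν) X*)]]`. -/
noncomputable def Delta {H : Type u} [NormedAddCommGroup H] [InnerProductSpace ℂ H]
    [CompleteSpace H] (ρ ν : ℝ) (X : H →L[ℂ] H) : ℝ :=
  numericalRadius
    (blockOp 0 ((alpha ρ : ℂ) • X)
      (((alpha ρ * (1 - 2 * ν) : ℝ) : ℂ) • ContinuousLinearMap.adjoint X)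
      ((beta ρ : ℂ) • (X + ((1 - 2 * ν : ℝ) : ℂ) • ContinuousLinearMap.adjoint X)))

/-- `|X| = (X* X)^(1/2)`. -/
noncomputable def opAbs {H : Type u} [NormedAddCommGroup H] [InnerProductSpace ℂ H]
    [CompleteSpace H] (X : H →L[ℂ] H) : H →L[ℂ] H :=
  CFC.abs X

end OperatorRadii

/-! Put c = 1 - 2ν and T = [[0, αX], [0, βX]]. Then Δ(X) = w(T + cT*), T² = β[[0, αX²], [0, βX²]],
and T*T + TT* is the matrix with entries 𝐀, 𝐁, 𝐁, 𝐂 (`delta_eq`, `radiusBlock_sq`,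
`adjoint_mul_add_mul_adjoint_radiusBlock`). For a unit vector z and p = |⟨Tz, z⟩|, |⟨(T + cT*)z,
z⟩|² ≤ c²p² + 2|c|p² + p². The last p² is at most ‖T*T + TT*‖/2, and the middle one is split by a
Buzano inequality into a norm term and |⟨T²z, z⟩|. It remains to see w(T) ≤ w_ρ(X), for X and for
X². Resolvent positivity of a ρ-contraction Z gives (2/ρ - 1)‖Zk‖² + |β||⟨Zk, k⟩| ≤ ‖k‖², and the
cross term α⟨Zk, h⟩ is absorbed because α²/4 = 2/ρ - 1. Passing to the infimum requires some
multiple of X to be a ρ-contraction, which an explicit dilation on ℓ²(ℤ; H) provides. -/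

namespace OperatorRadii

universe u

/-! ### Buzano's inequality and the quadratic form of T + cT*. -/

section NumericalRadius

variable {E : Type u} [NormedAddCommGroup E] [InnerProductSpace ℂ E]

/-- A Buzano-type inequality with a complex parameter. -/
theorem norm_mul_inner_mul_inner_le (lam : ℂ) (x y z : E) (hz : ‖z‖ = 1) :
    ‖lam‖ * (‖inner ℂ x z‖ * ‖inner ℂ z y‖) ≤
      max 1 ‖lam - 1‖ * (‖x‖ * ‖y‖) + ‖inner ℂ x y‖ := by
  set a : ℂ := inner ℂ z y with ha
  set y' : E := y - a • z with hy'
  set m : ℝ := max 1 ‖lam - 1‖ with hm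
  have hzz : inner ℂ z z = (1 : ℂ) := by simp [inner_self_eq_norm_sq_to_K, hz]
  have horth : inner ℂ z y' = (0 : ℂ) := by
    simp only [hy', inner_sub_right, inner_smul_right, hzz, ← ha]; ring
  have hpyth : ∀ b : ℂ, ‖b • z + y'‖ ^ 2 = ‖b‖ ^ 2 + ‖y'‖ ^ 2 := by
    intro b
    have h := norm_add_sq_eq_norm_sq_add_norm_sq_of_inner_eq_zero (𝕜 := ℂ) (b • z) y'
      (by rw [inner_smul_left, horth, mul_zero])
    rw [norm_smul, hz, mul_one] at h
    nlinarith [h]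
  have hy : ‖y‖ ^ 2 = ‖a‖ ^ 2 + ‖y'‖ ^ 2 := by
    rw [← hpyth a]; congr 2; simp [hy']
  have hm1 : 1 ≤ m := le_max_left _ _
  have hm2 : ‖lam - 1‖ ≤ m := le_max_right _ _
  -- The operator λ⟨z, ·⟩z - 1 acts as λ - 1 on the line of z and as -1 on its complement, so its
  -- norm is at most m.
  have hv : ‖(lam * a) • z - y‖ ≤ m * ‖y‖ := by
    have e : (lam * a) • z - y = -((-((lam - 1) * a)) • z + y') := by
      simp only [hy', sub_mul, neg_smul, sub_smul, one_mul]; abel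
    refine le_of_sq_le_sq ?_ (by positivity)
    rw [e, norm_neg, hpyth, norm_neg, norm_mul, mul_pow, mul_pow, hy, mul_add]
    have h1 : ‖lam - 1‖ ^ 2 ≤ m ^ 2 := by gcongr
    have h2 : 1 ≤ m ^ 2 := one_le_pow₀ hm1
    nlinarith [sq_nonneg ‖a‖, sq_nonneg ‖y'‖]
  have key : lam * (inner ℂ x z * a) = inner ℂ x ((lam * a) • z - y) + inner ℂ x y := by
    rw [inner_sub_right, inner_smul_right]; ring
  calc ‖lam‖ * (‖inner ℂ x z‖ * ‖a‖) = ‖lam * (inner ℂ x z * a)‖ := by simp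
    _ ≤ ‖inner ℂ x ((lam * a) • z - y)‖ + ‖inner ℂ x y‖ := by rw [key]; exact norm_add_le _ _
    _ ≤ ‖x‖ * (m * ‖y‖) + ‖inner ℂ x y‖ := by
        gcongr
        exact (norm_inner_le_norm _ _).trans (by gcongr)
    _ = _ := by ring

theorem norm_sq_add_norm_adjoint_sq_le [CompleteSpace E] (T : E →L[ℂ] E) (z : E) (hz : ‖z‖ = 1) :
    ‖T z‖ ^ 2 + ‖ContinuousLinearMap.adjoint T z‖ ^ 2 ≤
      ‖ContinuousLinearMap.adjoint T * T + T * ContinuousLinearMap.adjoint T‖ := by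
  set S := ContinuousLinearMap.adjoint T * T + T * ContinuousLinearMap.adjoint T with hS
  have h : inner ℂ (S z) z =
      ((‖T z‖ ^ 2 + ‖ContinuousLinearMap.adjoint T z‖ ^ 2 : ℝ) : ℂ) := by
    have e : S z = ContinuousLinearMap.adjoint T (T z) + T (ContinuousLinearMap.adjoint T z) := rfl
    rw [e, inner_add_left, ContinuousLinearMap.adjoint_inner_left,
      ← ContinuousLinearMap.adjoint_inner_right T _ z, inner_self_eq_norm_sq_to_K,
      inner_self_eq_norm_sq_to_K]
    push_cast; rfl
  have h2 := norm_inner_le_norm (𝕜 := ℂ) (S z) z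
  rw [h, Complex.norm_real, Real.norm_eq_abs, hz, mul_one] at h2
  have h3 := S.le_opNorm z
  rw [hz, mul_one] at h3
  exact (le_abs_self _).trans (h2.trans h3)

/-- A pointwise bound for the quadratic form of `T + c T*`. -/
theorem norm_inner_add_smul_adjoint_sq_le [CompleteSpace E] (T : E →L[ℂ] E) (c : ℝ) (lam : ℂ)
    (hlam : lam ≠ 0) (z : E) (hz : ‖z‖ = 1) :
    ‖inner ℂ ((T + (c : ℂ) • ContinuousLinearMap.adjoint T) z) z‖ ^ 2 ≤
      c ^ 2 * ‖inner ℂ (T z) z‖ ^ 2 + 2 * |c| / ‖lam‖ * ‖inner ℂ ((T ^ 2) z) z‖ +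
      (2 * |c| * max 1 ‖lam - 1‖ + ‖lam‖) / (2 * ‖lam‖) *
        ‖ContinuousLinearMap.adjoint T * T + T * ContinuousLinearMap.adjoint T‖ := by
  set N := ‖ContinuousLinearMap.adjoint T * T + T * ContinuousLinearMap.adjoint T‖ with hN
  set m := max 1 ‖lam - 1‖ with hm
  have hl : 0 < ‖lam‖ := norm_pos_iff.mpr hlam
  have hm0 : 0 ≤ m := zero_le_one.trans (le_max_left _ _)
  have hsum := norm_sq_add_norm_adjoint_sq_le T z hz
  rw [← hN] at hsum
  set p := ‖inner ℂ (T z) z‖ with hp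
  set q := ‖inner ℂ ((T ^ 2) z) z‖ with hq
  have hadj : ‖inner ℂ (ContinuousLinearMap.adjoint T z) z‖ = p := by
    rw [ContinuousLinearMap.adjoint_inner_left, hp, norm_inner_symm]
  have hadj' : ‖inner ℂ z (ContinuousLinearMap.adjoint T z)‖ = p := by
    rw [norm_inner_symm, hadj]
  have hbuz := norm_mul_inner_mul_inner_le lam (T z) (ContinuousLinearMap.adjoint T z) z hz
  have hsq : ‖inner ℂ (T z) (ContinuousLinearMap.adjoint T z)‖ = q := by
    rw [ContinuousLinearMap.adjoint_inner_right]
    rfl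
  rw [hadj', hsq, ← hp, ← hm] at hbuz
  have hp1 : p ≤ ‖T z‖ := by
    have := norm_inner_le_norm (𝕜 := ℂ) (T z) z
    rwa [hz, mul_one] at this
  have hp2 : p ≤ ‖ContinuousLinearMap.adjoint T z‖ := by
    have := norm_inner_le_norm (𝕜 := ℂ) (ContinuousLinearMap.adjoint T z) z
    rwa [hz, mul_one, hadj] at this
  have hp0 : 0 ≤ p := norm_nonneg _
  have hpp : p ^ 2 ≤ N / 2 := by nlinarith
  have hprod : ‖T z‖ * ‖ContinuousLinearMap.adjoint T z‖ ≤ N / 2 := by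
    nlinarith [sq_nonneg (‖T z‖ - ‖ContinuousLinearMap.adjoint T z‖)]
  have hpp' : p ^ 2 ≤ (m * (N / 2) + q) / ‖lam‖ := by
    rw [le_div_iff₀ hl]
    calc p ^ 2 * ‖lam‖ = ‖lam‖ * (p * p) := by ring
      _ ≤ _ := hbuz
      _ ≤ _ := by gcongr
  have htri : ‖inner ℂ ((T + (c : ℂ) • ContinuousLinearMap.adjoint T) z) z‖ ≤ p + |c| * p := by
    have e : (T + (c : ℂ) • ContinuousLinearMap.adjoint T) z =
      T z + (c : ℂ) • ContinuousLinearMap.adjoint T z := rfl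
    rw [e, inner_add_left, inner_smul_left]
    refine (norm_add_le _ _).trans ?_
    rw [norm_mul, hadj]
    simp [hp]
  calc _ ≤ (p + |c| * p) ^ 2 := by gcongr
    _ = |c| ^ 2 * p ^ 2 + 2 * |c| * p ^ 2 + p ^ 2 := by ring
    -- Each copy of p² is treated differently: kept, bounded by Buzano, bounded by N / 2.
    _ ≤ |c| ^ 2 * p ^ 2 + 2 * |c| * ((m * (N / 2) + q) / ‖lam‖) + N / 2 := by gcongr
    _ = _ := by rw [sq_abs]; field_simp; ring

end NumericalRadius

/-! ### From a unitary dilation to a numerical radius bound. -/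

section Dilation

variable {H : Type u} [NormedAddCommGroup H] [InnerProductSpace ℂ H] [CompleteSpace H]

/-- The resolvent positivity of a `ρ`-contraction, cleared of its denominator. -/
theorem IsRhoContraction.re_inner_nonneg {ρ : ℝ} (hρ : 0 < ρ) {Z : H →L[ℂ] H}
    (hZ : IsRhoContraction ρ Z) (ζ : ℂ) (hζ : ‖ζ‖ < 1) (k : H) :
    0 ≤ (inner ℂ (k + ((2 * ρ⁻¹ - 1 : ℝ) : ℂ) • ζ • Z k) (k - ζ • Z k)).re := by
  obtain ⟨K, _, _, _, J, U, hU, hdil⟩ := hZ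
  have hUn : ∀ x, ‖U x‖ = ‖x‖ := ContinuousLinearMap.norm_map_of_mem_unitary hU
  have hUnorm : ‖U‖ ≤ 1 := U.opNorm_le_bound zero_le_one fun x ↦ by rw [hUn, one_mul]
  set P := ContinuousLinearMap.adjoint J.toContinuousLinearMap with hP
  have hPJ : ∀ x, P (J x) = x := fun x ↦ by
    refine ext_inner_right ℂ fun y ↦ ?_
    rw [hP, ContinuousLinearMap.adjoint_inner_left]
    exact J.inner_map_map x y
  have hζU : ‖ζ • U‖ < 1 := by
    rw [norm_smul]
    nlinarith [norm_nonneg ζ, norm_nonneg U]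
  set v := k - ζ • Z k with hv
  have hsumm : Summable fun n : ℕ ↦ (ζ • U) ^ n := summable_geometric_of_norm_lt_one hζU
  set R := ∑' n : ℕ, (ζ • U) ^ n with hR
  -- g = (1 - ζU)⁻¹Jv, so the claim reduces to ‖g‖² - ‖ζUg‖² ≥ 0 once Pg is known.
  set g := R (J v) with hg
  have hgeq : J v = g - ζ • U g := by
    have h := mul_neg_geom_series (ζ • U) hζU
    rw [← hR] at h
    have := congrArg (fun S : K →L[ℂ] K ↦ S (J v)) h
    simpa [hg] using this.symm
  have hpos : 0 ≤ (inner ℂ (g + ζ • U g) (g - ζ • U g)).re := by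
    have e : (inner ℂ (g + ζ • U g) (g - ζ • U g)).re = ‖g‖ ^ 2 - ‖ζ • U g‖ ^ 2 := by
      rw [inner_add_left, inner_sub_right, inner_sub_right, ← inner_conj_symm (ζ • U g) g,
        inner_self_eq_norm_sq_to_K, inner_self_eq_norm_sq_to_K]
      simp only [Complex.coe_algebraMap, ← Complex.ofReal_pow, Complex.add_re, Complex.sub_re,
        Complex.ofReal_re, Complex.conj_re]
      ring
    rw [e, norm_smul, hUn, mul_pow]
    have : ‖ζ‖ ^ 2 ≤ 1 := pow_le_one₀ (norm_nonneg _) hζ.le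
    nlinarith [sq_nonneg ‖g‖]
  have hg1 : ∀ y, HasSum (fun n : ℕ ↦ P (((ζ • U) ^ n) y)) (P (R y)) := fun y ↦
    (hsumm.hasSum.mapL (ContinuousLinearMap.apply ℂ K y)).mapL P
  have hpow : ∀ n : ℕ, 1 ≤ n → ∀ x, P (((ζ • U) ^ n) (J x)) = (ρ⁻¹ : ℂ) • ζ ^ n • (Z ^ n) x := by
    intro n hn x
    have hρ' : (ρ : ℂ) ≠ 0 := by exact_mod_cast hρ.ne'
    rw [hdil n hn x, smul_pow, smul_apply, map_smul, smul_comm,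
      inv_smul_smul₀ hρ']
  -- Since v = (1 - ζZ)k, the terms with n ≥ 1 telescope; the n = 0 term lacks the factor ρ⁻¹.
  -- Writing the remainder through U makes it a term of a convergent series, so powers of Z need no
  -- estimate.
  have htel : ∀ N : ℕ, ∑ n ∈ Finset.range (N + 1), P (((ζ • U) ^ n) (J v)) =
      v + (ρ⁻¹ : ℂ) • (ζ • Z k) - P (((ζ • U) ^ (N + 1)) (J k)) := by
    intro N
    induction N with
    | zero =>
      rw [hpow 1 le_rfl]
      simp [hPJ]
    | succ N ih =>
      rw [Finset.sum_range_succ, ih, hpow _ (by omega), hpow _ (by omega), hpow _ (by omega), hv]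
      simp only [map_sub, map_smul, pow_succ, mul_apply_eq_comp]
      module
  have hPg : P g = v + (ρ⁻¹ : ℂ) • (ζ • Z k) := by
    have h1 := (Filter.tendsto_add_atTop_iff_nat 1).mpr (hg1 (J v)).tendsto_sum_nat
    have h0 : Filter.Tendsto (fun n : ℕ ↦ P (((ζ • U) ^ (n + 1)) (J k))) Filter.atTop (nhds 0) :=
      (Filter.tendsto_add_atTop_iff_nat 1).mpr (hg1 (J k)).summable.tendsto_atTop_zero
    have h2 := (tendsto_const_nhds (x := v + (ρ⁻¹ : ℂ) • (ζ • Z k))).sub h0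
    rw [sub_zero] at h2
    refine tendsto_nhds_unique h1 (h2.congr fun N ↦ ?_)
    exact (htel N).symm
  have e1 : g + ζ • U g = (2 : ℂ) • g - J v := by rw [hgeq]; module
  have e2 : k + ((2 * ρ⁻¹ - 1 : ℝ) : ℂ) • ζ • Z k = (2 : ℂ) • P g - v := by
    rw [hPg, hv]; push_cast; module
  have e3 : inner ℂ (P g) v = inner ℂ g (J v) := by
    rw [hP, ContinuousLinearMap.adjoint_inner_left]; rfl
  rw [e1, ← hgeq, inner_sub_left, inner_smul_left, J.inner_map_map] at hpos
  rw [e2, inner_sub_left, inner_smul_left, e3]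
  exact hpos

/-- Resolvent positivity at ζ = ru, with the phase u chosen so that β⟨ζZk, k⟩ = -r|β⟨Zk, k⟩|, then r
→ 1 from below. -/
theorem IsRhoContraction.norm_sq_add_le {ρ : ℝ} (hρ : 0 < ρ) {Z : H →L[ℂ] H}
    (hZ : IsRhoContraction ρ Z) (k : H) :
    (2 * ρ⁻¹ - 1) * ‖Z k‖ ^ 2 + |beta ρ| * ‖inner ℂ (Z k) k‖ ≤ ‖k‖ ^ 2 := by
  set w : ℂ := (beta ρ : ℂ) * inner ℂ (Z k) k with hw
  obtain ⟨u, hu, huw⟩ : ∃ u : ℂ, ‖u‖ = 1 ∧ (starRingEnd ℂ u) * w = -(‖w‖ : ℂ) := by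
    by_cases h : w = 0
    · exact ⟨1, by simp, by simp [h]⟩
    · have hn : (‖w‖ : ℂ) ≠ 0 := by exact_mod_cast norm_ne_zero_iff.mpr h
      refine ⟨-(w / ‖w‖), by simp [h], ?_⟩
      have := Complex.conj_mul' w
      simp only [map_neg, map_div₀, Complex.conj_ofReal]
      field_simp
      rw [this]
  have hr : ∀ r ∈ Set.Ioo (0 : ℝ) 1,
      (2 * ρ⁻¹ - 1) * (r ^ 2 * ‖Z k‖ ^ 2) + r * ‖w‖ ≤ ‖k‖ ^ 2 := by
    intro r hr
    have h := hZ.re_inner_nonneg hρ ((r : ℂ) * u)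
      (by rw [norm_mul, hu, mul_one]; simp [abs_of_pos hr.1, hr.2]) k
    set y := ((r : ℂ) * u) • Z k with hy
    have hyn : ‖y‖ ^ 2 = r ^ 2 * ‖Z k‖ ^ 2 := by
      rw [hy, norm_smul, norm_mul, hu, mul_pow]; simp
    have hyk : beta ρ * (inner ℂ y k).re = -(r * ‖w‖) := by
      have : (beta ρ : ℂ) * inner ℂ y k = -((r * ‖w‖ : ℝ) : ℂ) := by
        rw [hy, inner_smul_left, map_mul, Complex.conj_ofReal]
        push_cast
        linear_combination (r : ℂ) * huw
      have h2 := congrArg Complex.re this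
      rwa [Complex.re_ofReal_mul, Complex.neg_re, Complex.ofReal_re] at h2
    have e : (inner ℂ (k + ((2 * ρ⁻¹ - 1 : ℝ) : ℂ) • y) (k - y)).re =
        ‖k‖ ^ 2 - (2 * ρ⁻¹ - 1) * ‖y‖ ^ 2 + beta ρ * (inner ℂ y k).re := by
      rw [inner_add_left, inner_sub_right, inner_smul_left, Complex.conj_ofReal, Complex.add_re,
        Complex.re_ofReal_mul, inner_sub_right, Complex.sub_re, Complex.sub_re,
        ← inner_conj_symm k y, inner_self_eq_norm_sq_to_K, inner_self_eq_norm_sq_to_K, beta]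
      simp only [Complex.coe_algebraMap, ← Complex.ofReal_pow, Complex.ofReal_re, Complex.conj_re]
      ring
    rw [e, hyk, hyn] at h
    linarith
  have hlim : Filter.Tendsto
      (fun r : ℝ ↦ (2 * ρ⁻¹ - 1) * (r ^ 2 * ‖Z k‖ ^ 2) + r * ‖w‖)
      (nhdsWithin 1 (Set.Iio 1)) (nhds ((2 * ρ⁻¹ - 1) * (1 ^ 2 * ‖Z k‖ ^ 2) + 1 * ‖w‖)) :=
    (Continuous.tendsto (by fun_prop) 1).mono_left nhdsWithin_le_nhds
  have := le_of_tendsto hlim (Filter.mem_of_superset (Ioo_mem_nhdsLT zero_lt_one) hr)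
  rw [hw, norm_mul, Complex.norm_real, Real.norm_eq_abs] at this
  linarith

/-- The operator matrix `[[0, αX], [0, βX]]`, whose numerical radius is `w_ρ(X)`. -/
noncomputable def radiusBlock (ρ : ℝ) (X : H →L[ℂ] H) :
    WithLp 2 (H × H) →L[ℂ] WithLp 2 (H × H) :=
  blockOp 0 ((alpha ρ : ℂ) • X) 0 ((beta ρ : ℂ) • X)

theorem alpha_sq {ρ : ℝ} (hρ : ρ ∈ Set.Ioc (0 : ℝ) 2) : alpha ρ ^ 2 = 4 * (2 * ρ⁻¹ - 1) := by
  have h : 2⁻¹ ≤ ρ⁻¹ := inv_anti₀ hρ.1 hρ.2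
  rw [alpha, Real.sq_sqrt (by linarith)]
  ring

theorem norm_inner_radiusBlock_le_of_isRhoContraction {ρ : ℝ} (hρ : ρ ∈ Set.Ioc (0 : ℝ) 2)
    (X : H →L[ℂ] H) {t : ℝ} (ht : 0 < t) (hX : IsRhoContraction ρ (((t⁻¹ : ℝ) : ℂ) • X))
    (z : WithLp 2 (H × H)) (hz : ‖z‖ = 1) : ‖inner ℂ (radiusBlock ρ X z) z‖ ≤ t := by
  obtain ⟨h, k⟩ := z
  set Z := ((t⁻¹ : ℝ) : ℂ) • X with hZ
  have hXZ : X = (t : ℂ) • Z := by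
    have : (t : ℂ) ≠ 0 := by exact_mod_cast ht.ne'
    rw [hZ, Complex.ofReal_inv, smul_inv_smul₀ this]
  have hmain := hX.norm_sq_add_le hρ.1 k
  have ha := alpha_sq hρ
  have ha0 : 0 ≤ alpha ρ := Real.sqrt_nonneg _
  have hnorm : ‖h‖ ^ 2 + ‖k‖ ^ 2 = 1 := by
    have := WithLp.prod_norm_sq_eq_of_L2 (WithLp.toLp 2 (h, k))
    rw [hz] at this
    simpa using this.symm
  have e : inner ℂ (radiusBlock ρ X (WithLp.toLp 2 (h, k))) (WithLp.toLp 2 (h, k)) =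
      (t : ℂ) * ((alpha ρ : ℂ) * inner ℂ (Z k) h + (beta ρ : ℂ) * inner ℂ (Z k) k) := by
    rw [radiusBlock, blockOp_apply, hXZ, WithLp.prod_inner_apply]
    simp only [smul_apply, zero_apply, zero_add, inner_smul_left, Complex.conj_ofReal]
    ring
  rw [e, norm_mul, Complex.norm_real, Real.norm_eq_abs, abs_of_pos ht]
  refine mul_le_of_le_one_right ht.le ?_
  calc _ ≤ ‖(alpha ρ : ℂ) * inner ℂ (Z k) h‖ + ‖(beta ρ : ℂ) * inner ℂ (Z k) k‖ := norm_add_le _ _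
    _ = alpha ρ * ‖inner ℂ (Z k) h‖ + |beta ρ| * ‖inner ℂ (Z k) k‖ := by
      simp [abs_of_nonneg ha0]
    _ ≤ alpha ρ * (‖Z k‖ * ‖h‖) + |beta ρ| * ‖inner ℂ (Z k) k‖ := by
      gcongr; exact norm_inner_le_norm _ _
    -- The square gives α‖Zk‖‖h‖ ≤ (α²/4)‖Zk‖² + ‖h‖², and α²/4 = 2/ρ - 1 matches `hmain`.
    _ ≤ 1 := by nlinarith [sq_nonneg (alpha ρ * ‖Z k‖ - 2 * ‖h‖)]

end Dilation

/-! ### Operator-weighted bilateral shifts on ℓ²(ℤ; H). -/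

section WeightedShift

variable {H : Type u} [NormedAddCommGroup H]

/-- The `H`-valued sequences indexed by `ℤ` with square summable norms. -/
abbrev SeqSpace (H : Type u) [NormedAddCommGroup H] : Type u := lp (fun _ : ℤ ↦ H) 2

theorem SeqSpace.hasSum_norm_sq (f : SeqSpace H) : HasSum (fun n ↦ ‖f n‖ ^ 2) (‖f‖ ^ 2) := by
  have := lp.hasSum_norm (p := 2) (by norm_num) f
  simpa using this

theorem SeqSpace.hasSum_norm_sq_shift (f : SeqSpace H) (j : ℤ) :
    HasSum (fun n ↦ ‖f (n + j)‖ ^ 2) (‖f‖ ^ 2) :=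
  ((Equiv.addRight j).hasSum_iff (f := fun n ↦ ‖f n‖ ^ 2)).mpr f.hasSum_norm_sq

variable [InnerProductSpace ℂ H]

theorem memℓp_weightedShift (X : H →L[ℂ] H) (j : ℤ) (f : SeqSpace H) :
    Memℓp (fun n ↦ X (f (n + j))) 2 := by
  refine memℓp_gen ?_
  have h : Summable fun n ↦ ‖X‖ ^ 2 * ‖f (n + j)‖ ^ 2 :=
    (f.hasSum_norm_sq_shift j).summable.mul_left _
  refine Summable.of_nonneg_of_le (fun n ↦ by positivity) (fun n ↦ ?_) h
  rw [← mul_pow]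
  simpa using pow_le_pow_left₀ (norm_nonneg _) (X.le_opNorm (f (n + j))) 2

/-- The operator `(f n) ↦ (X f (n + j))` on square summable sequences. -/
noncomputable def weightedShift (X : H →L[ℂ] H) (j : ℤ) : SeqSpace H →L[ℂ] SeqSpace H :=
  LinearMap.mkContinuous
    { toFun := fun f ↦ ⟨fun n ↦ X (f (n + j)), memℓp_weightedShift X j f⟩
      map_add' := fun f g ↦ lp.ext (funext fun n ↦ map_add X _ _)
      map_smul' := fun c f ↦ lp.ext (funext fun n ↦ map_smul X _ _) }
    ‖X‖ fun f ↦ by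
      refine le_of_sq_le_sq ?_ (by positivity)
      rw [mul_pow]
      refine hasSum_le (fun n ↦ ?_) (SeqSpace.hasSum_norm_sq _)
        ((f.hasSum_norm_sq_shift j).mul_left (‖X‖ ^ 2))
      rw [← mul_pow]
      exact pow_le_pow_left₀ (norm_nonneg _) (X.le_opNorm (f (n + j))) 2

theorem weightedShift_apply (X : H →L[ℂ] H) (j : ℤ) (f : SeqSpace H) (n : ℤ) :
    weightedShift X j f n = X (f (n + j)) := rfl

theorem norm_weightedShift_le (X : H →L[ℂ] H) (j : ℤ) : ‖weightedShift X j‖ ≤ ‖X‖ :=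
  LinearMap.mkContinuous_norm_le _ (norm_nonneg _) _

theorem weightedShift_mul (X Y : H →L[ℂ] H) (i j : ℤ) :
    weightedShift X i * weightedShift Y j = weightedShift (X * Y) (i + j) := by
  refine ContinuousLinearMap.ext fun f ↦ lp.ext (funext fun n ↦ ?_)
  simp only [mul_apply_eq_comp, weightedShift_apply, add_assoc]

theorem weightedShift_one_zero : weightedShift (1 : H →L[ℂ] H) 0 = 1 :=
  ContinuousLinearMap.ext fun f ↦ lp.ext (funext fun n ↦ by simp [weightedShift_apply])

theorem weightedShift_pow (X : H →L[ℂ] H) (j : ℤ) (n : ℕ) :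
    weightedShift X j ^ n = weightedShift (X ^ n) (n * j) := by
  induction n with
  | zero => simp [weightedShift_one_zero]
  | succ n ih => rw [pow_succ, ih, weightedShift_mul, pow_succ]; push_cast; ring_nf

theorem commute_weightedShift_one (X : H →L[ℂ] H) (i j : ℤ) :
    Commute (weightedShift (1 : H →L[ℂ] H) i) (weightedShift X j) := by
  rw [Commute, SemiconjBy, weightedShift_mul, weightedShift_mul, one_mul, mul_one, add_comm]

theorem star_weightedShift [CompleteSpace H] (X : H →L[ℂ] H) (j : ℤ) :
    star (weightedShift X j) = weightedShift (star X) (-j) := by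
  refine ((ContinuousLinearMap.eq_adjoint_iff _ _).mpr fun f g ↦ ?_).symm
  rw [lp.inner_eq_tsum, lp.inner_eq_tsum,
    ← (Equiv.addRight j).tsum_eq fun n ↦ inner ℂ (weightedShift (star X) (-j) f n) (g n)]
  refine tsum_congr fun n ↦ ?_
  simp [weightedShift_apply, ContinuousLinearMap.star_eq_adjoint,
    ContinuousLinearMap.adjoint_inner_left]

theorem weightedShift_one_mem_unitary [CompleteSpace H] (j : ℤ) :
    weightedShift (1 : H →L[ℂ] H) j ∈ unitary (SeqSpace H →L[ℂ] SeqSpace H) := by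
  rw [Unitary.mem_iff, star_weightedShift, star_one, weightedShift_mul, weightedShift_mul]
  simp [weightedShift_one_zero]

theorem weightedShift_single_zero (X : H →L[ℂ] H) (j : ℤ) (h : H) :
    weightedShift X j (lp.single 2 0 h) 0 = if j = 0 then X h else 0 := by
  rw [weightedShift_apply, zero_add]
  split_ifs with hj
  · rw [hj, lp.single_apply_self]
  · rw [lp.single_apply_ne _ _ _ hj, map_zero]

end WeightedShift

/-! ### A norm bound for the geometric series without its constant term. -/

section SmallNorm

variable {A : Type*} [NormedRing A] [CompleteSpace A]

/-- The sum V satisfies V = y + Vy, hence ‖V‖(1 - ‖y‖) ≤ ‖y‖. -/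
theorem norm_tsum_pow_succ_le {y : A} {r : ℝ} (hy : ‖y‖ ≤ r) (hr : r ≤ 1 / 2) :
    ‖∑' k : ℕ, y ^ (k + 1)‖ ≤ 2 * r := by
  have hlt : ‖y‖ < 1 := by linarith
  set V := ∑' k : ℕ, y ^ (k + 1) with hV
  have h1 : V = y + V * y := by
    have h0 := geom_series_succ y hlt
    have hm := geom_series_mul_neg y hlt
    rw [← hV] at h0
    have h2 : ∑' k : ℕ, y ^ k = V + 1 := by rw [h0]; abel
    rw [h2, mul_sub, mul_one, add_mul, one_mul] at hm
    have := sub_eq_iff_eq_add.mp hm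
    have h3 : V + 1 = (y + V * y) + 1 := by rw [this]; abel
    exact add_right_cancel h3
  have h2 : ‖V‖ ≤ ‖y‖ + ‖V‖ * ‖y‖ := by
    calc ‖V‖ = ‖y + V * y‖ := by rw [← h1]
      _ ≤ _ := (norm_add_le _ _).trans (by gcongr; exact norm_mul_le _ _)
  nlinarith [norm_nonneg V, norm_nonneg y]

end SmallNorm

/-! ### Operators of small norm have ρ-dilations. -/

section Existence

variable {H : Type u} [NormedAddCommGroup H] [InnerProductSpace ℂ H] [CompleteSpace H]

/-- The quadratic form is ‖x‖² + 2c Re⟨Vx, x⟩ ≥ (1 - 2c‖V‖)‖x‖². -/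
theorem nonneg_one_add_smul {K : Type u} [NormedAddCommGroup K] [InnerProductSpace ℂ K]
    [CompleteSpace K] (V : K →L[ℂ] K) {c : ℝ} (hc : 0 ≤ c) (hV : 2 * c * ‖V‖ ≤ 1) :
    0 ≤ 1 + (c : ℂ) • (V + star V) := by
  rw [ContinuousLinearMap.nonneg_iff_isPositive, ContinuousLinearMap.isPositive_def]
  constructor
  · rw [← ContinuousLinearMap.isSelfAdjoint_iff_isSymmetric]
    rw [IsSelfAdjoint]
    simp [add_comm]
  · intro x
    have e : (1 + (c : ℂ) • (V + star V)) x =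
      x + (c : ℂ) • (V x + ContinuousLinearMap.adjoint V x) := rfl
    rw [ContinuousLinearMap.reApplyInnerSelf_apply, e, inner_add_left, inner_smul_left,
      inner_add_left, ContinuousLinearMap.adjoint_inner_left, inner_self_eq_norm_sq_to_K,
      ← inner_conj_symm x (V x)]
    have h1 : ‖inner ℂ (V x) x‖ ≤ ‖V‖ * ‖x‖ ^ 2 := by
      refine (norm_inner_le_norm _ _).trans ?_
      rw [pow_two, ← mul_assoc]
      gcongr
      exact V.le_opNorm x
    have h2 := (abs_le.mp ((Complex.abs_re_le_norm _).trans h1)).1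
    simp only [Complex.conj_ofReal, Complex.coe_algebraMap, ← Complex.ofReal_pow, map_add,
      RCLike.re_to_complex, Complex.ofReal_re, Complex.re_ofReal_mul, Complex.add_re,
      Complex.conj_re]
    nlinarith [sq_nonneg ‖x‖]

/-- A positive operator commuting with a unitary twists it into a `ρ`-dilation. -/
theorem isRhoContraction_of_commute_unitary {K : Type u} [NormedAddCommGroup K]
    [InnerProductSpace ℂ K] [CompleteSpace K] {ρ : ℝ} {X : H →L[ℂ] H} (ι : H →L[ℂ] K)
    {U G : K →L[ℂ] K} (hU : U ∈ unitary (K →L[ℂ] K)) (hG : 0 ≤ G) (hUG : Commute U G)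
    (hone : ∀ h, ContinuousLinearMap.adjoint ι (G (ι h)) = h)
    (hpow : ∀ n : ℕ, 1 ≤ n → ∀ h,
      (X ^ n) h = (ρ : ℂ) • ContinuousLinearMap.adjoint ι ((U ^ n) (G (ι h)))) :
    IsRhoContraction ρ X := by
  -- Qι is the isometric embedding: Q commutes with U, so compressing Uⁿ along Qι gives ι*UⁿGι.
  set Q := CFC.sqrt G with hQ
  have hQQ : Q * Q = G := CFC.sqrt_mul_sqrt_self G hG
  have hQs : ContinuousLinearMap.adjoint Q = Q := (CFC.sqrt_nonneg G).isSelfAdjoint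
  have hUQ : Commute U Q := (hUG.symm.cfcₙ_nnreal _).symm
  have hQQ' : ∀ x, Q (Q x) = G x := fun x ↦ by rw [← hQQ]; rfl
  have hadj : ContinuousLinearMap.adjoint (Q ∘L ι) = ContinuousLinearMap.adjoint ι ∘L Q := by
    rw [ContinuousLinearMap.adjoint_comp, hQs]
  have hnorm : ∀ h, ‖(Q ∘L ι) h‖ = ‖h‖ :=
    (ContinuousLinearMap.norm_map_iff_adjoint_comp_self _).mpr <| by
      rw [hadj]
      exact ContinuousLinearMap.ext fun h ↦ by simp [hQQ', hone]
  refine ⟨K, _, _, inferInstance, ⟨(Q ∘L ι).toLinearMap, hnorm⟩, U, hU, fun n hn h ↦ ?_⟩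
  have hcomm : (U ^ n) (Q (ι h)) = Q ((U ^ n) (ι h)) :=
    congrArg (fun T : K →L[ℂ] K ↦ T (ι h)) (hUQ.pow_left n).eq
  have hcommG : (U ^ n) (G (ι h)) = G ((U ^ n) (ι h)) :=
    congrArg (fun T : K →L[ℂ] K ↦ T (ι h)) (hUG.pow_left n).eq
  change _ = (ρ : ℂ) • ContinuousLinearMap.adjoint (Q ∘L ι) ((U ^ n) (Q (ι h)))
  rw [hadj, hcomm, ContinuousLinearMap.comp_apply, hQQ', ← hcommG]
  exact hpow n hn h

/-- Take G = 1 + ρ⁻¹(V + V*) with V = Y + Y² + ⋯, an operator Poisson kernel. In ι*UⁿGι with n ≥ 1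
only the term Yⁿ survives and leaves ρ⁻¹Xⁿ. The bound ρ/4 on ‖Y‖ yields ‖V‖ ≤ ρ/2, which is what G ≥
0 needs. -/
theorem isRhoContraction_of_moments {K : Type u} [NormedAddCommGroup K]
    [InnerProductSpace ℂ K] [CompleteSpace K] {ρ : ℝ} (hρ : ρ ∈ Set.Ioc (0 : ℝ) 2)
    {X : H →L[ℂ] H} (ι : H →L[ℂ] K) {U Y : K →L[ℂ] K} (hU : U ∈ unitary (K →L[ℂ] K))
    (hY : ‖Y‖ ≤ ρ / 4) (hUY : Commute U Y) (hUY' : Commute U (star Y))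
    (hone : ∀ (n : ℕ) (h : H),
      ContinuousLinearMap.adjoint ι ((U ^ n) (ι h)) = if n = 0 then h else 0)
    (hpow : ∀ (n k : ℕ) (h : H), ContinuousLinearMap.adjoint ι ((U ^ n) ((Y ^ (k + 1)) (ι h))) =
      if k + 1 = n then (X ^ n) h else 0)
    (hpow' : ∀ (n k : ℕ) (h : H),
      ContinuousLinearMap.adjoint ι ((U ^ n) ((star Y ^ (k + 1)) (ι h))) = 0) :
    IsRhoContraction ρ X := by
  obtain ⟨hρ0, hρ2⟩ := hρ
  have hlt : ‖Y‖ < 1 := by linarith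
  have hsum : Summable fun k : ℕ ↦ Y ^ (k + 1) :=
    (summable_nat_add_iff 1).mpr (summable_geometric_of_norm_lt_one hlt)
  have hsum' : Summable fun k : ℕ ↦ (star Y) ^ (k + 1) :=
    (summable_nat_add_iff 1).mpr (summable_geometric_of_norm_lt_one (by rwa [norm_star]))
  set V := ∑' k : ℕ, Y ^ (k + 1) with hV
  have hstarV : star V = ∑' k : ℕ, (star Y) ^ (k + 1) := by
    rw [hV, tsum_star]; simp only [star_pow]
  have hVn : ‖V‖ ≤ 2 * (ρ / 4) := norm_tsum_pow_succ_le hY (by linarith)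
  have hG0 : 0 ≤ 1 + ((ρ⁻¹ : ℝ) : ℂ) • (V + star V) := by
    refine nonneg_one_add_smul V (inv_nonneg.mpr hρ0.le) ?_
    calc 2 * ρ⁻¹ * ‖V‖ ≤ 2 * ρ⁻¹ * (2 * (ρ / 4)) := by gcongr
      _ = 1 := by field_simp; norm_num
  have hUV : Commute U V := Commute.tsum_right _ fun k ↦ hUY.pow_right _
  have hUV' : Commute U (star V) := by
    rw [hstarV]
    exact Commute.tsum_right _ fun k ↦ hUY'.pow_right _
  have hUG : Commute U (1 + ((ρ⁻¹ : ℝ) : ℂ) • (V + star V)) :=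
    (Commute.one_right U).add_right ((hUV.add_right hUV').smul_right _)
  have hVmom : ∀ (n : ℕ) (h : H), ContinuousLinearMap.adjoint ι ((U ^ n) (V (ι h))) =
      if n = 0 then 0 else (X ^ n) h := by
    intro n h
    have h1 : HasSum (fun k : ℕ ↦ ContinuousLinearMap.adjoint ι ((U ^ n) ((Y ^ (k + 1)) (ι h))))
        (ContinuousLinearMap.adjoint ι ((U ^ n) (V (ι h)))) :=
      ((hsum.hasSum.mapL (ContinuousLinearMap.apply ℂ K (ι h))).mapL (U ^ n)).mapL _
    simp only [hpow] at h1
    cases n with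
    | zero => simpa using h1.tsum_eq.symm
    | succ m =>
      refine h1.unique ?_
      simpa using hasSum_ite_eq m ((X ^ (m + 1)) h)
  have hVmom' : ∀ (n : ℕ) (h : H),
      ContinuousLinearMap.adjoint ι ((U ^ n) (star V (ι h))) = 0 := by
    intro n h
    have h1 : HasSum
        (fun k : ℕ ↦ ContinuousLinearMap.adjoint ι ((U ^ n) ((star Y ^ (k + 1)) (ι h))))
        (ContinuousLinearMap.adjoint ι ((U ^ n) (star V (ι h)))) := by
      rw [hstarV]
      exact ((hsum'.hasSum.mapL (ContinuousLinearMap.apply ℂ K (ι h))).mapL (U ^ n)).mapL _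
    simp only [hpow'] at h1
    exact h1.unique hasSum_zero
  have hGmom : ∀ (n : ℕ) (h : H), ContinuousLinearMap.adjoint ι
      ((U ^ n) ((1 + ((ρ⁻¹ : ℝ) : ℂ) • (V + star V)) (ι h))) =
        (if n = 0 then h else 0) +
          ((ρ⁻¹ : ℝ) : ℂ) • ((if n = 0 then 0 else (X ^ n) h) + 0) := by
    intro n h
    rw [← hone, ← hVmom, ← hVmom' n h]
    simp only [add_apply, smul_apply, one_apply_eq_self, map_add, map_smul]
  refine isRhoContraction_of_commute_unitary ι hU hG0 hUG (fun h ↦ ?_) fun n hn h ↦ ?_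
  · simpa using hGmom 0 h
  · have hρ' : (ρ : ℂ) ≠ 0 := by exact_mod_cast hρ0.ne'
    rw [hGmom, if_neg (by omega), if_neg (by omega), zero_add, add_zero, Complex.ofReal_inv,
      smul_inv_smul₀ hρ']

/-- The embedding of `H` as the sequences supported at `0`. -/
noncomputable def singleZero (H : Type u) [NormedAddCommGroup H] [InnerProductSpace ℂ H] :
    H →L[ℂ] SeqSpace H :=
  (lp.lsingle (E := fun _ : ℤ ↦ H) (𝕜 := ℂ) 2 0).mkContinuous 1 fun h ↦ by
    rw [one_mul]
    exact (lp.norm_single (E := fun _ : ℤ ↦ H) (p := 2) (by norm_num) 0 h).le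

theorem adjoint_singleZero_apply (f : SeqSpace H) :
    ContinuousLinearMap.adjoint (singleZero H) f = f 0 := by
  refine ext_inner_right ℂ fun y ↦ ?_
  rw [ContinuousLinearMap.adjoint_inner_left]
  exact lp.inner_single_right (𝕜 := ℂ) (G := fun _ : ℤ ↦ H) 0 y f

/-- An operator of small norm is a `ρ`-contraction. -/
theorem isRhoContraction_of_norm_le {ρ : ℝ} (hρ : ρ ∈ Set.Ioc (0 : ℝ) 2) (X : H →L[ℂ] H)
    (hX : ‖X‖ ≤ ρ / 4) : IsRhoContraction ρ X := by
  have hpair : ∀ (Z : H →L[ℂ] H) (n : ℕ) (j : ℤ) (h : H),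
      ContinuousLinearMap.adjoint (singleZero H)
        ((weightedShift (1 : H →L[ℂ] H) (-1) ^ n) (weightedShift Z j (singleZero H h))) =
      if j = n then Z h else 0 := by
    intro Z n j h
    rw [← mul_apply_eq_comp, weightedShift_pow, weightedShift_mul, one_pow, one_mul,
      adjoint_singleZero_apply]
    have e : (n * -1 + j : ℤ) = 0 ↔ j = n := by omega
    have hs := weightedShift_single_zero Z (n * -1 + j) h
    simp only [e] at hs
    exact hs
  -- U and Y shift in opposite directions, so UⁿYʲ returns to position 0 exactly when j = n; Y*
  -- shifts the same way as U, so its positive powers never return.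
  refine isRhoContraction_of_moments (K := SeqSpace H) hρ (singleZero H)
    (U := weightedShift 1 (-1)) (Y := weightedShift X 1) (weightedShift_one_mem_unitary _)
    ((norm_weightedShift_le X 1).trans hX) (commute_weightedShift_one _ _ _) ?_ ?_ ?_ ?_
  · rw [star_weightedShift]
    exact commute_weightedShift_one _ _ _
  · intro n h
    have := hpair 1 n 0 h
    rw [weightedShift_one_zero] at this
    have e : (0 : ℤ) = n ↔ n = 0 := by omega
    simpa only [e, one_apply_eq_self] using this
  · intro n k h
    rw [weightedShift_pow X, hpair]
    by_cases hk : k + 1 = n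
    · subst hk
      rw [if_pos (by push_cast; ring), if_pos rfl]
    · rw [if_neg (by omega), if_neg hk]
  · intro n k h
    rw [star_weightedShift, weightedShift_pow (star X), hpair, if_neg (by omega)]

/-- Without this, the infimum defining `operatorRadius` could be the default value 0 of an empty set
and would bound nothing. -/
theorem exists_isRhoContraction {ρ : ℝ} (hρ : ρ ∈ Set.Ioc (0 : ℝ) 2) (X : H →L[ℂ] H) :
    {t : ℝ | 0 < t ∧ IsRhoContraction ρ (((t⁻¹ : ℝ) : ℂ) • X)}.Nonempty := by
  have hρ0 := hρ.1
  have ht : 0 < 4 * ρ⁻¹ * (‖X‖ + 1) := by positivity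
  refine ⟨4 * ρ⁻¹ * (‖X‖ + 1), ht, isRhoContraction_of_norm_le hρ _ ?_⟩
  rw [norm_smul, Complex.norm_real, Real.norm_eq_abs, abs_of_pos (inv_pos.mpr ht),
    inv_mul_le_iff₀ ht]
  calc ‖X‖ ≤ ‖X‖ + 1 := by linarith
    _ = _ := by field_simp

end Existence

/-! ### Algebra of 2 × 2 operator matrices. -/

section BlockOp

variable {H : Type u} [NormedAddCommGroup H] [InnerProductSpace ℂ H]

theorem blockOp_mul (S X Y T S' X' Y' T' : H →L[ℂ] H) :
    blockOp S X Y T * blockOp S' X' Y' T' =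
      blockOp (S * S' + X * Y') (S * X' + X * T') (Y * S' + T * Y') (Y * X' + T * T') := by
  refine ContinuousLinearMap.ext ?_
  rintro ⟨h, k⟩
  rw [mul_apply_eq_comp, blockOp_apply, blockOp_apply, blockOp_apply]
  simp only [map_add, add_apply, mul_apply_eq_comp]
  congr 2 <;> abel

theorem blockOp_add (S X Y T S' X' Y' T' : H →L[ℂ] H) :
    blockOp S X Y T + blockOp S' X' Y' T' = blockOp (S + S') (X + X') (Y + Y') (T + T') := by
  refine ContinuousLinearMap.ext ?_
  rintro ⟨h, k⟩
  rw [add_apply, blockOp_apply, blockOp_apply, blockOp_apply, ← WithLp.toLp_add]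
  simp only [add_apply, Prod.mk_add_mk]
  congr 2 <;> abel

theorem smul_blockOp (c : ℂ) (S X Y T : H →L[ℂ] H) :
    c • blockOp S X Y T = blockOp (c • S) (c • X) (c • Y) (c • T) := by
  refine ContinuousLinearMap.ext ?_
  rintro ⟨h, k⟩
  rw [smul_apply, blockOp_apply, blockOp_apply, ← WithLp.toLp_smul]
  simp only [smul_apply, Prod.smul_mk, smul_add]

end BlockOp

/-! ### Identities for T = `radiusBlock ρ X` and the bound w(T) ≤ w_ρ(X). -/

section Main

variable {H : Type u} [NormedAddCommGroup H] [InnerProductSpace ℂ H] [CompleteSpace H]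

theorem operatorRadius_nonneg (ρ : ℝ) (X : H →L[ℂ] H) : 0 ≤ operatorRadius ρ X :=
  Real.sInf_nonneg fun _ ht ↦ ht.1.le

theorem norm_inner_radiusBlock_le {ρ : ℝ} (hρ : ρ ∈ Set.Ioc (0 : ℝ) 2) (X : H →L[ℂ] H)
    (z : WithLp 2 (H × H)) (hz : ‖z‖ = 1) :
    ‖inner ℂ (radiusBlock ρ X z) z‖ ≤ operatorRadius ρ X :=
  le_csInf (exists_isRhoContraction hρ X) fun _ ht ↦
    norm_inner_radiusBlock_le_of_isRhoContraction hρ X ht.1 ht.2 z hz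

theorem adjoint_blockOp (S X Y T : H →L[ℂ] H) :
    ContinuousLinearMap.adjoint (blockOp S X Y T) =
      blockOp (ContinuousLinearMap.adjoint S) (ContinuousLinearMap.adjoint Y)
        (ContinuousLinearMap.adjoint X) (ContinuousLinearMap.adjoint T) := by
  refine ((ContinuousLinearMap.eq_adjoint_iff _ _).mpr ?_).symm
  rintro ⟨h, k⟩ ⟨h', k'⟩
  rw [blockOp_apply, blockOp_apply, WithLp.prod_inner_apply, WithLp.prod_inner_apply]
  simp only [inner_add_left, inner_add_right, ContinuousLinearMap.adjoint_inner_left]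
  ring

theorem adjoint_radiusBlock (ρ : ℝ) (X : H →L[ℂ] H) :
    ContinuousLinearMap.adjoint (radiusBlock ρ X) =
      blockOp 0 0 ((alpha ρ : ℂ) • ContinuousLinearMap.adjoint X)
        ((beta ρ : ℂ) • ContinuousLinearMap.adjoint X) := by
  rw [radiusBlock, adjoint_blockOp]
  simp only [map_zero, map_smulₛₗ, Complex.conj_ofReal]

/-- The zero first column makes the square a block of the same shape; this is the source of both β
and w_ρ(X²) in the second term of the bound. -/
theorem radiusBlock_sq (ρ : ℝ) (X : H →L[ℂ] H) :
    radiusBlock ρ X ^ 2 = (beta ρ : ℂ) • radiusBlock ρ (X ^ 2) := by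
  rw [pow_two, radiusBlock, radiusBlock, blockOp_mul, smul_blockOp]
  congr 1 <;> simp [pow_two, smul_smul, mul_comm]

theorem delta_eq (ρ ν : ℝ) (X : H →L[ℂ] H) :
    Delta ρ ν X = numericalRadius (radiusBlock ρ X +
      ((1 - 2 * ν : ℝ) : ℂ) • ContinuousLinearMap.adjoint (radiusBlock ρ X)) := by
  rw [adjoint_radiusBlock, radiusBlock, smul_blockOp, blockOp_add, Delta]
  congr 2
  · simp
  · simp
  · rw [smul_smul, zero_add, ← Complex.ofReal_mul, mul_comm]
  · rw [smul_add, smul_comm]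

theorem opAbs_sq (X : H →L[ℂ] H) : opAbs X ^ 2 = ContinuousLinearMap.adjoint X * X :=
  CFC.abs_sq X

theorem adjoint_mul_add_mul_adjoint_radiusBlock (ρ : ℝ) (X : H →L[ℂ] H) :
    ContinuousLinearMap.adjoint (radiusBlock ρ X) * radiusBlock ρ X +
      radiusBlock ρ X * ContinuousLinearMap.adjoint (radiusBlock ρ X) =
    blockOp (((alpha ρ ^ 2 : ℝ) : ℂ) • opAbs (ContinuousLinearMap.adjoint X) ^ 2)
      (((alpha ρ * beta ρ : ℝ) : ℂ) • opAbs (ContinuousLinearMap.adjoint X) ^ 2)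
      (((alpha ρ * beta ρ : ℝ) : ℂ) • opAbs (ContinuousLinearMap.adjoint X) ^ 2)
      (((alpha ρ ^ 2 + beta ρ ^ 2 : ℝ) : ℂ) • opAbs X ^ 2 +
        ((beta ρ ^ 2 : ℝ) : ℂ) • opAbs (ContinuousLinearMap.adjoint X) ^ 2) := by
  rw [opAbs_sq, opAbs_sq, ContinuousLinearMap.adjoint_adjoint, adjoint_radiusBlock, radiusBlock,
    blockOp_mul, blockOp_mul, blockOp_add]
  simp only [mul_zero, zero_mul, add_zero, zero_add, smul_mul_smul_comm]
  push_cast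
  congr 1 <;> module

end Main

end OperatorRadii

theorem theorem2p11 {H : Type*} [NormedAddCommGroup H] [InnerProductSpace ℂ H] [CompleteSpace H]
    (ρ ν : ℝ) (hρ : ρ ∈ Set.Ioc (0 : ℝ) 2) (hν : ν ∈ Set.Icc (0 : ℝ) 1)
    (X : H →L[ℂ] H) (lam : ℂ) (hlam : lam ≠ 0)
    (A B C : H →L[ℂ] H)
    (hA : A = ((OperatorRadii.alpha ρ ^ 2 : ℝ) : ℂ) •
      OperatorRadii.opAbs (ContinuousLinearMap.adjoint X) ^ 2)
    (hB : B = ((OperatorRadii.alpha ρ * OperatorRadii.beta ρ : ℝ) : ℂ) •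
      OperatorRadii.opAbs (ContinuousLinearMap.adjoint X) ^ 2)
    (hC : C = ((OperatorRadii.alpha ρ ^ 2 + OperatorRadii.beta ρ ^ 2 : ℝ) : ℂ) •
        OperatorRadii.opAbs X ^ 2 +
      ((OperatorRadii.beta ρ ^ 2 : ℝ) : ℂ) •
        OperatorRadii.opAbs (ContinuousLinearMap.adjoint X) ^ 2) :
    OperatorRadii.Delta ρ ν X ^ 2 ≤
      (1 - 2 * ν) ^ 2 * OperatorRadii.operatorRadius ρ X ^ 2 +
      2 * ‖(((1 - 2 * ν) * OperatorRadii.beta ρ : ℝ) : ℂ) / lam‖ *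
        OperatorRadii.operatorRadius ρ (X ^ 2) +
      (2 * |1 - 2 * ν| * max 1 ‖lam - 1‖ + ‖lam‖) / (2 * ‖lam‖) *
        ‖OperatorRadii.blockOp A B B C‖ := by
  have hblock := OperatorRadii.adjoint_mul_add_mul_adjoint_radiusBlock ρ X
  rw [← hA, ← hB, ← hC] at hblock
  have hr := OperatorRadii.operatorRadius_nonneg ρ (X ^ 2)
  have hm : (0 : ℝ) ≤ max 1 ‖lam - 1‖ := zero_le_one.trans (le_max_left _ _)
  set R := (1 - 2 * ν) ^ 2 * OperatorRadii.operatorRadius ρ X ^ 2 +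
      2 * ‖(((1 - 2 * ν) * OperatorRadii.beta ρ : ℝ) : ℂ) / lam‖ *
        OperatorRadii.operatorRadius ρ (X ^ 2) +
      (2 * |1 - 2 * ν| * max 1 ‖lam - 1‖ + ‖lam‖) / (2 * ‖lam‖) *
        ‖OperatorRadii.blockOp A B B C‖ with hR
  have hR0 : 0 ≤ R := by positivity
  rw [OperatorRadii.delta_eq, ← Real.sq_sqrt hR0]
  -- These supremum bounds do not ask for a unit vector to exist, so H = 0 is covered.
  refine pow_le_pow_left₀ (Real.sSup_nonneg ?_) (Real.sSup_le ?_ (Real.sqrt_nonneg _)) 2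
  · rintro r ⟨z, -, rfl⟩
    exact norm_nonneg _
  · rintro r ⟨z, hz, rfl⟩
    refine Real.le_sqrt_of_sq_le ?_
    refine (OperatorRadii.norm_inner_add_smul_adjoint_sq_le _ _ lam hlam z hz).trans ?_
    have h1 := OperatorRadii.norm_inner_radiusBlock_le hρ X z hz
    have h2 := OperatorRadii.norm_inner_radiusBlock_le hρ (X ^ 2) z hz
    rw [hblock, OperatorRadii.radiusBlock_sq, smul_apply, inner_smul_left, Complex.conj_ofReal,
      norm_mul, Complex.norm_real, Real.norm_eq_abs, hR, norm_div, Complex.norm_real,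
      Real.norm_eq_abs, abs_mul]
    have h3 : 2 * |1 - 2 * ν| / ‖lam‖ * (|OperatorRadii.beta ρ| *
          ‖inner ℂ (OperatorRadii.radiusBlock ρ (X ^ 2) z) z‖) ≤
        2 * (|1 - 2 * ν| * |OperatorRadii.beta ρ| / ‖lam‖) *
          OperatorRadii.operatorRadius ρ (X ^ 2) := by
      calc _ = 2 * (|1 - 2 * ν| * |OperatorRadii.beta ρ| / ‖lam‖) *
          ‖inner ℂ (OperatorRadii.radiusBlock ρ (X ^ 2) z) z‖ := by ring
        _ ≤ _ := by gcongr
    gcongr
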